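/- Let $J\subseteq\mathbb R$ be a nonempty open interval, $a:J\to(0,\infty)$ a smooth function, and $(S,h)$ a smooth three-dimensional Riemannian manifold of constant sectional curvature $k\in\mathbb R$. Consider the four-dimensional FLRW spacetime $M=J\times S$, $g=-dt^2+a(t)^2h$, with comoving unit timelike vector field $u=\partial_t$ and with $u^\flat = g(u,\cdot)$. For a timelike plane $T\subset T_qM$, spanned by $v,e$ with $g(v,v)=-1$, $g(e,e)=1$, $g(v,e)=0$, let $K(T)=-g(R(v,e)e,v)$ be its sectional curvature, where $R(X,Y)Z=\nabla_X\nabla_YZ-\nabla_Y\nabla_XZ-\nabla_{[X,Y]}Z$, and let $\mathrm{Ric}(Y,Z)=\operatorname{tr}\big(X\mapsto R(X,Y)Z\big)$ and let $\mathrm{Scal}$ be the $g$-trace of $\mathrm{Ric}$. The strong energy condition is: $\mathrm{Ric}(X,X)\ge 0$ for every timelike vector $X$. Then there are functions $\rho,p:M\to\mathbb R$ such that the Einstein equations for a perfect fluid hold: $$\mathrm{Ric}-\tfrac12 \mathrm{Scal}\,g=8\pi\big[(\rho+p)\,u^\flat\otimes u^\flat+p\,g\big],\qquad(*)$$ and $K(T)\le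 0$ for all timelike planes $T$ (at all points of $M$) if and only if the strong energy condition holds. Moreover, for all functions $\rho,p:M\to\mathbb R$ that satisfy $(*)$: 1. $K(T)\le 0$ for all timelike planes $T$ if and only if $\rho+p\ge 0$ and $\rho+3p\ge 0$ everywhere on $M$. 2. $\rho+p\ge 0$ and $\rho+3p\ge 0$ hold everywhere on $M$ if and only if the strong energy condition holds. 3. If $\rho>0$ and $p\ge 0$ everywhere on $M$, then $K(T)<0$ for all timelike planes $T$. -/

import Mathlib

set_option maxSynthPendingDepth 3

open scoped Manifold ContDiff

noncomputable section

namespace FLRW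

/-! ### Levi-Civita curvature of a metric in coordinates -/

section Coordinates

variable {E : Type*} [NormedAddCommGroup E] [NormedSpace ℝ E]

/-- Christoffel symbols of the metric `G` on (an open subset of) the vector space `E`: the vector
`christoffel G y v w` is characterised by
`G y (christoffel G y v w) z = (D_v G (w, z) + D_w G (v, z) - D_z G (v, w)) / 2`. -/
def christoffel (G : E → E →L[ℝ] E →L[ℝ] ℝ) (y : E) : E →L[ℝ] E →L[ℝ] E :=
  let D : E →L[ℝ] E →L[ℝ] E →L[ℝ] ℝ := fderiv ℝ G y
  let flip : (E →L[ℝ] E →L[ℝ] ℝ) →L[ℝ] (E →L[ℝ] E →L[ℝ] ℝ) :=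
    (ContinuousLinearMap.flipₗᵢ ℝ E E ℝ).toContinuousLinearEquiv.toContinuousLinearMap
  let L : E →L[ℝ] E →L[ℝ] E →L[ℝ] ℝ := (1 / 2 : ℝ) • (D + D.flip - flip.comp D.flip)
  (ContinuousLinearMap.compL ℝ E (E →L[ℝ] ℝ) E (G y).inverse).comp L

/-- The Riemann tensor of `G` in coordinates, with `Γ = christoffel G` and the sign convention
`R(u, v)w = ∇_u ∇_v w - ∇_v ∇_u w - ∇_[u, v] w`, that is, for constant `u`, `v`, `w`,
`R(u, v)w = (D_u Γ)(v, w) - (D_v Γ)(u, w) + Γ(u, Γ(v, w)) - Γ(v, Γ(u, w))`. -/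
def coordRiemann (G : E → E →L[ℝ] E →L[ℝ] ℝ) (y : E) : E →L[ℝ] E →L[ℝ] E →L[ℝ] E :=
  fderiv ℝ (christoffel G) y - (fderiv ℝ (christoffel G) y).flip
    + (ContinuousLinearMap.compL ℝ E E E).bilinearComp (christoffel G y) (christoffel G y)
    - ((ContinuousLinearMap.compL ℝ E E E).bilinearComp (christoffel G y) (christoffel G y)).flip

theorem christoffel_apply (G : E → E →L[ℝ] E →L[ℝ] ℝ) (y v w : E) :
    christoffel G y v w = (G y).inverse ((1 / 2 : ℝ) • (fderiv ℝ G y v w + fderiv ℝ G y w v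
      - ((fderiv ℝ G y).flip v).flip w)) := rfl

theorem coordRiemann_apply (G : E → E →L[ℝ] E →L[ℝ] ℝ) (y u v w : E) :
    coordRiemann G y u v w =
      fderiv ℝ (christoffel G) y u v w - fderiv ℝ (christoffel G) y v u w
        + christoffel G y u (christoffel G y v w) - christoffel G y v (christoffel G y u w) := rfl

/-- The Ricci tensor `Ric(v, w) = trace (u ↦ R(u, v)w)` in coordinates. -/
def coordRicci (G : E → E →L[ℝ] E →L[ℝ] ℝ) (y : E) : E →ₗ[ℝ] E →ₗ[ℝ] ℝ :=
  LinearMap.mk₂ ℝ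
    (fun v w => LinearMap.trace ℝ E (((coordRiemann G y).flip v).flip w).toLinearMap)
    (by intros; rw [← map_add]; congr 1; ext; simp)
    (by intros; rw [← map_smul]; congr 1; ext; simp)
    (by intros; rw [← map_add]; congr 1; ext; simp)
    (by intros; rw [← map_smul]; congr 1; ext; simp)

theorem coordRicci_apply (G : E → E →L[ℝ] E →L[ℝ] ℝ) (y v w : E) :
    coordRicci G y v w =
      LinearMap.trace ℝ E (((coordRiemann G y).flip v).flip w).toLinearMap := rfl

/-- The scalar curvature in coordinates: the trace of the endomorphism of `E` obtained from the
Ricci tensor by raising an index with `G`. -/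
def coordScalar [FiniteDimensional ℝ E] (G : E → E →L[ℝ] E →L[ℝ] ℝ) (y : E) : ℝ :=
  LinearMap.trace ℝ E ((G y).inverse.toLinearMap ∘ₗ
    (LinearMap.toContinuousLinearMap : (E →ₗ[ℝ] ℝ) ≃ₗ[ℝ] (E →L[ℝ] ℝ)).toLinearMap ∘ₗ
      coordRicci G y)

end Coordinates

/-! ### Curvature of a metric on a manifold -/

section Manifold

variable {E : Type*} [NormedAddCommGroup E] [NormedSpace ℝ E]
  {H : Type*} [TopologicalSpace H] (I : ModelWithCorners ℝ E H) [I.Boundaryless]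
  (M : Type*) [TopologicalSpace M] [ChartedSpace H M]

/-- A field of bilinear forms on the tangent spaces of `M`. -/
abbrev BilinField : Type _ :=
  ∀ x : M, TangentSpace I x →L[ℝ] TangentSpace I x →L[ℝ] ℝ

variable {I} {M}

/-- The expression of `g` in the preferred chart at `x₀`: the pullback of `g` under the inverse of
the chart. -/
def chartMetric (g : BilinField I M) (x₀ : M) (y : E) : E →L[ℝ] E →L[ℝ] ℝ :=
  let d : E →L[ℝ] E := mfderiv 𝓘(ℝ, E) I (extChartAt I x₀).symm y
  ContinuousLinearMap.bilinearComp (E := E) (F := E) (g ((extChartAt I x₀).symm y)) d d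

theorem chartMetric_apply (g : BilinField I M) (x₀ : M) (y v w : E) :
    chartMetric g x₀ y v w = g ((extChartAt I x₀).symm y)
      (mfderiv 𝓘(ℝ, E) I (extChartAt I x₀).symm y v)
      (mfderiv 𝓘(ℝ, E) I (extChartAt I x₀).symm y w) := rfl

/-- The Riemann tensor `R(u, v)w` of `g` at `x`, computed in the preferred chart at `x`. (The
tangent space at `x` is by definition the model space `E`, identified through this very chart.) -/
def riemann (g : BilinField I M) (x : M) (u v w : TangentSpace I x) : TangentSpace I x :=
  coordRiemann (chartMetric g x) (extChartAt I x x) u v w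

/-- The sectional curvature of the (nondegenerate) plane spanned by `v` and `w`. -/
def sectional (g : BilinField I M) (x : M) (v w : TangentSpace I x) : ℝ :=
  g x (riemann g x v w w) v / (g x v v * g x w w - g x v w ^ 2)

/-- The Ricci tensor `Ric(v, w) = trace (u ↦ R(u, v)w)` of `g` at `x`. -/
def ricci (g : BilinField I M) (x : M) (v w : TangentSpace I x) : ℝ :=
  coordRicci (chartMetric g x) (extChartAt I x x) v w

/-- The scalar curvature of `g` at `x`. -/
def scalar [FiniteDimensional ℝ E] (g : BilinField I M) (x : M) : ℝ :=
  coordScalar (chartMetric g x) (extChartAt I x x)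

/-- Everywhere nonpositive timelike sectional curvatures: `K(T) ≤ 0` for every point `x` and every
timelike plane `T` of `T_x M`, given by a basis `u, e` that is orthonormal
(`g(u, u) = -1`, `g(e, e) = 1`, `g(u, e) = 0`). -/
def TimelikeSectionalNonpos (g : BilinField I M) : Prop :=
  ∀ (x : M) (u e : TangentSpace I x), g x u u = -1 → g x e e = 1 → g x u e = 0 →
    sectional g x u e ≤ 0

/-- All timelike sectional curvatures are strictly negative. -/
def TimelikeSectionalNeg (g : BilinField I M) : Prop :=
  ∀ (x : M) (u e : TangentSpace I x), g x u u = -1 → g x e e = 1 → g x u e = 0 →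
    sectional g x u e < 0

/-- The strong energy condition `Ric(X, X) ≥ 0` for all timelike vectors `X`. -/
def StrongEnergyCondition (g : BilinField I M) : Prop :=
  ∀ (x : M) (X : TangentSpace I x), g x X X < 0 → 0 ≤ ricci g x X X

/-- The Einstein equations `Ric - R g / 2 = 8 π T` for a perfect fluid with energy density `ρ`,
pressure `p` and unit velocity field `U`, that is, with `T = (ρ + p) U♭ ⊗ U♭ + p g`. -/
def EinsteinPerfectFluid [FiniteDimensional ℝ E] (g : BilinField I M)
    (U : ∀ x : M, TangentSpace I x) (ρ p : M → ℝ) : Prop :=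
  ∀ (x : M) (X Y : TangentSpace I x),
    ricci g x X Y - 1 / 2 * scalar g x * g x X Y =
      8 * Real.pi * ((ρ x + p x) * (g x (U x) X * g x (U x) Y) + p x * g x X Y)

/-- All tangent planes have sectional curvature `k`. -/
def HasConstantCurvature (g : BilinField I M) (k : ℝ) : Prop :=
  ∀ (x : M) (v w : TangentSpace I x), LinearIndependent ℝ ![v, w] → sectional g x v w = k

end Manifold

/-! ### FLRW spacetimes -/

/-- The data of a (four-dimensional) FLRW spacetime `-dt² + a(t)² h` on `J × S`: an open interval
`J`, a positive smooth scale factor `a` on `J`, and a smooth Riemannian metric `h` of constant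
curvature on the three-manifold `S`. -/
structure FLRWData (S : Type*) [TopologicalSpace S] [ChartedSpace (EuclideanSpace ℝ (Fin 3)) S]
    [IsManifold 𝓘(ℝ, EuclideanSpace ℝ (Fin 3)) ∞ S] where
  /-- The time interval. -/
  J : TopologicalSpace.Opens ℝ
  nonempty : (J : Set ℝ).Nonempty
  ordConnected : (J : Set ℝ).OrdConnected
  /-- The scale factor (only its values on `J` matter). -/
  a : ℝ → ℝ
  a_smooth : ContDiffOn ℝ ∞ a J
  a_pos : ∀ t ∈ J, 0 < a t
  /-- The spatial metric. -/
  h : Bundle.ContMDiffRiemannianMetric 𝓘(ℝ, EuclideanSpace ℝ (Fin 3)) ∞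
    (EuclideanSpace ℝ (Fin 3))
    (fun s : S => TangentSpace 𝓘(ℝ, EuclideanSpace ℝ (Fin 3)) s)
  /-- The spatial curvature. -/
  k : ℝ
  constantCurvature : HasConstantCurvature (fun s => h.inner s) k

namespace FLRWData

variable {S : Type*} [TopologicalSpace S] [ChartedSpace (EuclideanSpace ℝ (Fin 3)) S]
  [IsManifold 𝓘(ℝ, EuclideanSpace ℝ (Fin 3)) ∞ S]

/-- The model with corners of the four-manifold `J × S`. -/
abbrev model : ModelWithCorners ℝ (ℝ × EuclideanSpace ℝ (Fin 3))
    (ModelProd ℝ (EuclideanSpace ℝ (Fin 3))) :=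
  𝓘(ℝ, ℝ).prod 𝓘(ℝ, EuclideanSpace ℝ (Fin 3))

/-- The spacetime metric `g = -dt² + a(t)² h` on `J × S`. -/
def metric (F : FLRWData S) : BilinField model (F.J × S) := fun q =>
  (-((ContinuousLinearMap.mul ℝ ℝ).bilinearComp
      (ContinuousLinearMap.fst ℝ ℝ (EuclideanSpace ℝ (Fin 3)))
      (ContinuousLinearMap.fst ℝ ℝ (EuclideanSpace ℝ (Fin 3))))
    + F.a q.1 ^ 2 • ContinuousLinearMap.bilinearComp
      (E := EuclideanSpace ℝ (Fin 3)) (F := EuclideanSpace ℝ (Fin 3)) (F.h.inner q.2)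
      (ContinuousLinearMap.snd ℝ ℝ (EuclideanSpace ℝ (Fin 3)))
      (ContinuousLinearMap.snd ℝ ℝ (EuclideanSpace ℝ (Fin 3))) :
    (ℝ × EuclideanSpace ℝ (Fin 3)) →L[ℝ] (ℝ × EuclideanSpace ℝ (Fin 3)) →L[ℝ] ℝ)

theorem metric_apply (F : FLRWData S) (q : F.J × S) (τ σ : ℝ) (v w : EuclideanSpace ℝ (Fin 3)) :
    F.metric q ((τ, v) : ℝ × EuclideanSpace ℝ (Fin 3)) ((σ, w) : ℝ × EuclideanSpace ℝ (Fin 3)) =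
      -(τ * σ) + F.a q.1 ^ 2 * F.h.inner q.2 v w := rfl

/-- The comoving unit timelike vector field `∂_t`. -/
def comoving (F : FLRWData S) (q : F.J × S) : TangentSpace model q :=
  ((1, 0) : ℝ × EuclideanSpace ℝ (Fin 3))

end FLRWData

end FLRW

end

/-!
The curvature of `-dt² + a(t)² h` on `J × S`, with `h` of constant curvature `k` on the
`n`-dimensional manifold `S`, is an algebraic expression in two functions of time: the radial
curvature `r = a'' / a` and the spatial curvature `c = (k + a'²) / a²`. Writing `B = a² h`, a
timelike plane with orthonormal basis `u, e` has `K = r + (r - c) x`, where `x` is the Gram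
determinant of the spatial parts of `u, e` for `B`. Since `x` takes all values in `[0, ∞)` and no
others, `K ≤ 0` on all timelike planes means `r ≤ 0` and `r ≤ c`.

On the vector `∂_t + v` the Ricci curvature is `-n r + (r + (n - 1) c) B(v, v)`, and this vector is
timelike exactly when `B(v, v) ∈ [0, 1)`. So the strong energy condition says that this affine
function is nonnegative at `0` and at `1`, that is, that `-n r ≥ 0` and `(n - 1) (c - r) ≥ 0`: the
same two inequalities. Finally the Einstein equations amount to
`8π (ρ + p) = (n - 1) (c - r)` and `8π ((n - 2) ρ + n p) = -n (n - 1) r`.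
-/

open scoped Topology

namespace FLRW

/-! ### Algebraic curvature tensors -/

section CurvatureTensor

variable {V A : Type*} [AddCommGroup V] [AddCommGroup A]

/-- Algebraic curvature tensors: `D u v w z` stands for `⟨R(u, v)w, z⟩`. Additivity in
the second and fourth slots follows from the skew symmetries. -/
structure IsCurvatureTensor (D : V → V → V → V → A) : Prop where
  add_left : ∀ u u' v w z, D (u + u') v w z = D u v w z + D u' v w z
  add_third : ∀ u v w w' z, D u v (w + w') z = D u v w z + D u v w' z
  swap_left : ∀ u v w z, D v u w z = -D u v w z
  swap_right : ∀ u v w z, D u v z w = -D u v w z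
  cyclic : ∀ u v w z, D u v w z + D v w u z + D w u v z = 0

theorem IsCurvatureTensor.eq_zero_of_sectional_eq_zero [IsAddTorsionFree A]
    {D : V → V → V → V → A} (hD : IsCurvatureTensor D) (sec : ∀ u v, D u v v u = 0)
    (u v w z : V) : D u v w z = 0 := by
  have self_right (u v w : V) : D u v w w = 0 := self_eq_neg.1 (hD.swap_right u v w w)
  have add_second (u v v' w z : V) : D u (v + v') w z = D u v w z + D u v' w z := by
    rw [hD.swap_left, hD.add_left, hD.swap_left u v, hD.swap_left u v', neg_add, neg_neg, neg_neg]
  have add_fourth (u v w z z' : V) : D u v w (z + z') = D u v w z + D u v w z' := by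
    rw [hD.swap_right, hD.add_third, hD.swap_right u v w z, hD.swap_right u v w z', neg_add,
      neg_neg, neg_neg]
  have middle_symm (u v z : V) : D z v v u = D u v v z := by
    have h := hD.cyclic z u v v
    rw [self_right, hD.swap_right u v v z, hD.swap_left z v u v,
      hD.swap_right z v v u] at h
    grind
  have middle_self (u v z : V) : D u v v z = 0 := by
    have h := sec (u + z) v
    rw [hD.add_left, add_fourth, add_fourth, sec, sec, middle_symm] at h
    grind
  have middle_swap (u v w z : V) : D u w v z = -D u v w z := by
    have h := middle_self u (v + w) z
    rw [add_second, hD.add_third, hD.add_third, middle_self, middle_self] at h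
    grind
  have h := hD.cyclic u v w z
  rw [hD.swap_left w v u, middle_swap w u v, hD.swap_left u w v, middle_swap u v w] at h
  grind

end CurvatureTensor

/-! ### The Levi-Civita connection in coordinates -/

section Coordinates

variable {E : Type*} [NormedAddCommGroup E] [NormedSpace ℝ E]
  {G G' : E → E →L[ℝ] E →L[ℝ] ℝ} {y : E}

theorem christoffel_congr (h : G =ᶠ[𝓝 y] G') : christoffel G =ᶠ[𝓝 y] christoffel G' := by
  filter_upwards [h.eventuallyEq_nhds] with z hz
  simp only [christoffel, hz.fderiv_eq, hz.eq_of_nhds]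

theorem coordRiemann_congr (h : G =ᶠ[𝓝 y] G') : coordRiemann G y = coordRiemann G' y := by
  have hΓ := christoffel_congr h
  simp only [coordRiemann, hΓ.fderiv_eq, hΓ.eq_of_nhds]

theorem coordRicci_congr (h : G =ᶠ[𝓝 y] G') : coordRicci G y = coordRicci G' y := by
  ext v w
  simp only [coordRicci_apply, coordRiemann_congr h]

theorem coordScalar_congr [FiniteDimensional ℝ E] (h : G =ᶠ[𝓝 y] G') :
    coordScalar G y = coordScalar G' y := by
  simp only [coordScalar, coordRicci_congr h, h.eq_of_nhds]

theorem apply_christoffel (hG : (G y).IsInvertible) (v w z : E) :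
    G y (christoffel G y v w) z =
      1 / 2 * (fderiv ℝ G y v w z + fderiv ℝ G y w v z - fderiv ℝ G y z v w) := by
  rw [christoffel_apply, hG.self_apply_inverse]
  simp [smul_eq_mul]

theorem christoffel_eq_of_koszul (hG : (G y).IsInvertible) {v w X : E}
    (h : ∀ z, G y X z =
      1 / 2 * (fderiv ℝ G y v w z + fderiv ℝ G y w v z - fderiv ℝ G y z v w)) :
    christoffel G y v w = X :=
  hG.injective <| ContinuousLinearMap.ext fun z => by rw [apply_christoffel hG, h]

theorem contDiffAt_christoffel [CompleteSpace E] {m n : WithTop ℕ∞} (hG : ContDiffAt ℝ n G y)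
    (hi : (G y).IsInvertible) (hmn : m + 1 ≤ n) : ContDiffAt ℝ m (christoffel G) y := by
  have hD : ContDiffAt ℝ m (fderiv ℝ G) y := hG.fderiv_right hmn
  have hinv : ContDiffAt ℝ m (fun z => (G z).inverse) y :=
    hi.contDiffAt_map_inverse.comp y (hG.of_le (le_self_add.trans hmn))
  let flip₁₂ := (ContinuousLinearMap.flipₗᵢ ℝ E E
    (E →L[ℝ] ℝ)).toContinuousLinearEquiv.toContinuousLinearMap
  let flip₂₃ := (ContinuousLinearMap.flipₗᵢ ℝ E E ℝ).toContinuousLinearEquiv.toContinuousLinearMap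
  have hflip : ContDiffAt ℝ m (fun z => flip₁₂ (fderiv ℝ G z)) y :=
    flip₁₂.contDiff.contDiffAt.comp y hD
  have hL : ContDiffAt ℝ m (fun z => (1 / 2 : ℝ) • (fderiv ℝ G z + flip₁₂ (fderiv ℝ G z) -
      flip₂₃.comp (flip₁₂ (fderiv ℝ G z)))) y :=
    ((hD.add hflip).sub (contDiffAt_const.clm_comp hflip)).const_smul (1 / 2 : ℝ)
  exact ((ContinuousLinearMap.compL ℝ E (E →L[ℝ] ℝ) E).contDiff.contDiffAt.comp y hinv).clm_comp hL

theorem fderiv_clm_apply₂ {F₁ F₂ F₃ : Type*} [NormedAddCommGroup F₁] [NormedSpace ℝ F₁]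
    [NormedAddCommGroup F₂] [NormedSpace ℝ F₂] [NormedAddCommGroup F₃] [NormedSpace ℝ F₃]
    {G : E → F₁ →L[ℝ] F₂ →L[ℝ] F₃} (hG : DifferentiableAt ℝ G y) (u : E) (v : F₁) (w : F₂) :
    fderiv ℝ G y u v w = fderiv ℝ (fun z => G z v w) y u := by
  have hv : HasFDerivAt (fun z => G z v) ((fderiv ℝ G y).flip v) y := by
    simpa using hG.hasFDerivAt.clm_apply (hasFDerivAt_const v y)
  have hvw : HasFDerivAt (fun z => G z v w) (((fderiv ℝ G y).flip v).flip w) y := by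
    simpa using hv.clm_apply (hasFDerivAt_const w y)
  rw [hvw.fderiv]
  rfl

theorem fderiv_symm_of_eventually_symm {F F' : Type*} [NormedAddCommGroup F] [NormedSpace ℝ F]
    [NormedAddCommGroup F'] [NormedSpace ℝ F'] {G : E → F →L[ℝ] F →L[ℝ] F'}
    (hG : DifferentiableAt ℝ G y) (hs : ∀ᶠ z in 𝓝 y, ∀ v w, G z v w = G z w v) (u : E) (v w : F) :
    fderiv ℝ G y u v w = fderiv ℝ G y u w v := by
  rw [fderiv_clm_apply₂ hG, fderiv_clm_apply₂ hG,
    Filter.EventuallyEq.fderiv_eq (hs.mono fun z hz => hz v w)]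

theorem coordRiemann_swap (G : E → E →L[ℝ] E →L[ℝ] ℝ) (y u v w : E) :
    coordRiemann G y v u w = -coordRiemann G y u v w := by
  simp only [coordRiemann_apply]
  abel

/-- `G` is a `C²` pseudo-Riemannian metric near the point `y` of a vector space. Nondegeneracy is
only asked for at `y`, as it propagates to nearby points. -/
structure IsPseudoRiemannianAt (G : E → E →L[ℝ] E →L[ℝ] ℝ) (y : E) : Prop where
  contDiffAt : ContDiffAt ℝ 2 G y
  eventually_symm : ∀ᶠ z in 𝓝 y, ∀ v w, G z v w = G z w v
  isInvertible : (G y).IsInvertible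

namespace IsPseudoRiemannianAt

theorem differentiableAt (h : IsPseudoRiemannianAt G y) : DifferentiableAt ℝ G y :=
  h.contDiffAt.differentiableAt (by simp)

theorem symm (h : IsPseudoRiemannianAt G y) (v w : E) : G y v w = G y w v :=
  h.eventually_symm.self_of_nhds v w

theorem fderiv_symm (h : IsPseudoRiemannianAt G y) (u v w : E) :
    fderiv ℝ G y u v w = fderiv ℝ G y u w v :=
  fderiv_symm_of_eventually_symm h.differentiableAt h.eventually_symm u v w

theorem christoffel_symm (h : IsPseudoRiemannianAt G y) (v w : E) :
    christoffel G y v w = christoffel G y w v := by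
  refine christoffel_eq_of_koszul h.isInvertible fun z => ?_
  rw [apply_christoffel h.isInvertible, h.fderiv_symm z v w]
  ring

theorem metric_compatible (h : IsPseudoRiemannianAt G y) (u v w : E) :
    fderiv ℝ G y u v w = G y (christoffel G y u v) w + G y v (christoffel G y u w) := by
  rw [h.symm v, apply_christoffel h.isInvertible, apply_christoffel h.isInvertible,
    h.fderiv_symm v u w, h.fderiv_symm w u v, h.fderiv_symm u w v]
  ring

variable [CompleteSpace E]

theorem eventually (h : IsPseudoRiemannianAt G y) : ∀ᶠ z in 𝓝 y, IsPseudoRiemannianAt G z := by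
  have hopen : IsOpen {f : E →L[ℝ] (E →L[ℝ] ℝ) | f.IsInvertible} := ContinuousLinearEquiv.isOpen
  filter_upwards [h.contDiffAt.eventually (by simp), h.eventually_symm.eventually_nhds,
    h.contDiffAt.continuousAt.eventually_mem (hopen.mem_nhds h.isInvertible)] with z hC hS hI
  exact ⟨hC, hS, hI⟩

theorem differentiableAt_christoffel (h : IsPseudoRiemannianAt G y) :
    DifferentiableAt ℝ (christoffel G) y :=
  (contDiffAt_christoffel h.contDiffAt h.isInvertible
    one_add_one_eq_two.le).differentiableAt one_ne_zero

theorem fderiv_christoffel_symm (h : IsPseudoRiemannianAt G y) (u v w : E) :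
    fderiv ℝ (christoffel G) y u v w = fderiv ℝ (christoffel G) y u w v :=
  fderiv_symm_of_eventually_symm h.differentiableAt_christoffel
    (h.eventually.mono fun _ hz => hz.christoffel_symm) u v w

theorem bianchi_first (h : IsPseudoRiemannianAt G y) (u v w : E) :
    coordRiemann G y u v w + coordRiemann G y v w u + coordRiemann G y w u v = 0 := by
  simp only [coordRiemann_apply]
  rw [h.fderiv_christoffel_symm u v w, h.fderiv_christoffel_symm v w u,
    h.fderiv_christoffel_symm w u v, h.christoffel_symm v w, h.christoffel_symm u w,
    h.christoffel_symm v u]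
  abel

theorem fderiv_fderiv_apply (h : IsPseudoRiemannianAt G y) (u v w z : E) :
    fderiv ℝ (fderiv ℝ G) y u v w z =
      G y (fderiv ℝ (christoffel G) y u v w) z + G y w (fderiv ℝ (christoffel G) y u v z)
      + fderiv ℝ G y u (christoffel G y v w) z + fderiv ℝ G y u w (christoffel G y v z) := by
  have hG := h.differentiableAt.hasFDerivAt
  have hΓ (w : E) : HasFDerivAt (fun x => christoffel G x v w)
      (((fderiv ℝ (christoffel G) y).flip v).flip w) y := by
    simpa using (h.differentiableAt_christoffel.hasFDerivAt.clm_apply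
      (hasFDerivAt_const v y)).clm_apply (hasFDerivAt_const w y)
  have hD : HasFDerivAt (fun x => fderiv ℝ G x v w z)
      ((((fderiv ℝ (fderiv ℝ G) y).flip v).flip w).flip z) y := by
    have hD' : DifferentiableAt ℝ (fderiv ℝ G) y :=
      (h.contDiffAt.fderiv_right (m := 1) one_add_one_eq_two.le).differentiableAt one_ne_zero
    simpa using ((hD'.hasFDerivAt.clm_apply (hasFDerivAt_const v y)).clm_apply
      (hasFDerivAt_const w y)).clm_apply (hasFDerivAt_const z y)
  have hcompat : (fun x => fderiv ℝ G x v w z) =ᶠ[𝓝 y]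
      fun x => G x (christoffel G x v w) z + G x w (christoffel G x v z) :=
    h.eventually.mono fun x hx => hx.metric_compatible v w z
  have hsum := ((hG.clm_apply (hΓ w)).clm_apply (hasFDerivAt_const z y)).add
    ((hG.clm_apply (hasFDerivAt_const w y)).clm_apply (hΓ z))
  have heq := congrArg (· u) ((hD.congr_of_eventuallyEq hcompat.symm).unique hsum)
  simp only [ContinuousLinearMap.flip_apply, ContinuousLinearMap.flip_add,
    ContinuousLinearMap.comp_apply, ContinuousLinearMap.comp_zero, add_apply, zero_add] at heq
  linarith

theorem apply_coordRiemann_skew (h : IsPseudoRiemannianAt G y) (u v w z : E) :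
    G y (coordRiemann G y u v w) z = -G y (coordRiemann G y u v z) w := by
  have hsymm : fderiv ℝ (fderiv ℝ G) y u v w z = fderiv ℝ (fderiv ℝ G) y v u w z := by
    rw [h.contDiffAt.isSymmSndFDerivAt (by simp) u v]
  simp only [h.fderiv_fderiv_apply, h.metric_compatible] at hsymm
  rw [h.symm (coordRiemann G y u v z) w]
  simp only [coordRiemann_apply, map_add, map_sub, add_apply, sub_apply]
  linarith

theorem isCurvatureTensor_sub_const (h : IsPseudoRiemannianAt G y) (k : ℝ) :
    IsCurvatureTensor fun u v w z =>
      G y (coordRiemann G y u v w - k • (G y v w • u - G y u w • v)) z where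
  add_left u u' v w z := by
    simp only [map_add, map_sub, map_smul, smul_add, add_apply, sub_apply, smul_apply, smul_eq_mul]
    ring
  add_third u v w w' z := by
    simp only [map_add, map_sub, map_smul, add_apply, sub_apply, smul_apply, smul_eq_mul]
    ring
  swap_left u v w z := by
    simp only [coordRiemann_swap G y u v, map_sub, map_neg, map_smul, sub_apply, neg_apply,
      smul_apply, smul_eq_mul]
    ring
  swap_right u v w z := by
    simp only [h.apply_coordRiemann_skew u v w z, map_sub, map_smul, sub_apply, smul_apply,
      smul_eq_mul]
    ring
  cyclic u v w z := by
    have hb := congrArg (fun x => G y x z) (h.bianchi_first u v w)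
    simp only [map_add, map_zero, add_apply, zero_apply] at hb
    simp only [h.symm w v, h.symm u w, h.symm v u, map_sub, map_smul, sub_apply, smul_apply,
      smul_eq_mul]
    linarith

theorem coordRiemann_eq_of_sectional (h : IsPseudoRiemannianAt G y) {k : ℝ}
    (hk : ∀ v w, G y (coordRiemann G y v w w) v = k * (G y v v * G y w w - G y v w ^ 2))
    (u v w : E) : coordRiemann G y u v w = k • (G y v w • u - G y u w • v) := by
  refine sub_eq_zero.1 (h.isInvertible.injective (ContinuousLinearMap.ext fun z => ?_))
  have hsec (u v : E) :
      G y (coordRiemann G y u v v - k • (G y v v • u - G y u v • v)) u = 0 := by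
    simp only [hk, h.symm v u, map_sub, map_smul, sub_apply, smul_apply, smul_eq_mul]
    ring
  simpa using (h.isCurvatureTensor_sub_const k).eq_zero_of_sectional_eq_zero hsec u v w z

end IsPseudoRiemannianAt

end Coordinates

/-! ### Warped products in coordinates -/

theorem trace_prod {R M N : Type*} [CommRing R] [AddCommGroup M] [Module R M] [Module.Free R M]
    [Module.Finite R M] [AddCommGroup N] [Module R N] [Module.Free R N] [Module.Finite R N]
    (f : M × N →ₗ[R] M × N) :
    LinearMap.trace R (M × N) f =
      LinearMap.trace R M (LinearMap.fst R M N ∘ₗ f ∘ₗ LinearMap.inl R M N)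
        + LinearMap.trace R N (LinearMap.snd R M N ∘ₗ f ∘ₗ LinearMap.inr R M N) := by
  have hf : f = (f ∘ₗ LinearMap.inl R M N) ∘ₗ LinearMap.fst R M N
      + (f ∘ₗ LinearMap.inr R M N) ∘ₗ LinearMap.snd R M N := by
    ext <;> simp [Prod.mk_zero_zero]
  conv_lhs => rw [hf]
  rw [map_add, LinearMap.trace_comp_comm', LinearMap.trace_comp_comm' _ (LinearMap.snd R M N)]

section CoordWarped

variable {E : Type*} [NormedAddCommGroup E] [NormedSpace ℝ E]

/-- The Lorentzian form `-dt² + B` on `ℝ × E`. -/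
noncomputable def lorentzForm (B : E →L[ℝ] E →L[ℝ] ℝ) : ℝ × E →L[ℝ] ℝ × E →L[ℝ] ℝ :=
  -((ContinuousLinearMap.mul ℝ ℝ).bilinearComp (ContinuousLinearMap.fst ℝ ℝ E)
      (ContinuousLinearMap.fst ℝ ℝ E))
    + B.bilinearComp (ContinuousLinearMap.snd ℝ ℝ E) (ContinuousLinearMap.snd ℝ ℝ E)

theorem lorentzForm_apply (B : E →L[ℝ] E →L[ℝ] ℝ) (V W : ℝ × E) :
    lorentzForm B V W = -(V.1 * W.1) + B V.2 W.2 := rfl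

/-- The warped product metric `-dt² + a(t)² H` on the vector space `ℝ × E`. -/
noncomputable def coordWarped (a : ℝ → ℝ) (H : E → E →L[ℝ] E →L[ℝ] ℝ) (p : ℝ × E) :
    ℝ × E →L[ℝ] ℝ × E →L[ℝ] ℝ :=
  lorentzForm (a p.1 ^ 2 • H p.2)

theorem coordWarped_apply (a : ℝ → ℝ) (H : E → E →L[ℝ] E →L[ℝ] ℝ) (p V W : ℝ × E) :
    coordWarped a H p V W = -(V.1 * W.1) + a p.1 ^ 2 * H p.2 V.2 W.2 := rfl

/-- The sectional curvature of the planes containing `∂_t` in the metric `-dt² + a(t)² h`. -/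
noncomputable def radialCurvature (a : ℝ → ℝ) (t : ℝ) : ℝ :=
  deriv (deriv a) t / a t

/-- The sectional curvature of the planes orthogonal to `∂_t` in the metric `-dt² + a(t)² h` when
`h` has constant sectional curvature `k`. -/
noncomputable def spatialCurvature (a : ℝ → ℝ) (k t : ℝ) : ℝ :=
  (k + deriv a t ^ 2) / a t ^ 2

variable {a : ℝ → ℝ} {H : E → E →L[ℝ] E →L[ℝ] ℝ} {t : ℝ} {y : E}

theorem isInvertible_coordWarped (h0 : a t ≠ 0) (hH : (H y).IsInvertible) :
    (coordWarped a H (t, y)).IsInvertible := by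
  let inv : (ℝ × E →L[ℝ] ℝ) →L[ℝ] ℝ × E :=
    (-ContinuousLinearMap.apply ℝ ℝ ((1, 0) : ℝ × E)).prod
      ((a t ^ 2)⁻¹ • (H y).inverse ∘L
        (ContinuousLinearMap.compL ℝ E (ℝ × E) ℝ).flip (ContinuousLinearMap.inr ℝ ℝ E))
  refine .of_inverse (g := inv) (ContinuousLinearMap.ext fun φ => ?_)
    (ContinuousLinearMap.ext fun V => ?_)
  · ext <;> simp [inv, coordWarped_apply, hH.self_apply_inverse, h0, Prod.mk_zero_zero]
  · have hsnd : (coordWarped a H (t, y) V) ∘L .inr ℝ ℝ E = a t ^ 2 • H y V.2 := by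
      ext w
      simp [coordWarped_apply]
    ext <;> simp [inv, coordWarped_apply, hsnd, hH.inverse_apply_self, h0]

theorem contDiffAt_coordWarped {n : WithTop ℕ∞} (ha : ContDiffAt ℝ n a t)
    (hH : ContDiffAt ℝ n H y) : ContDiffAt ℝ n (coordWarped a H) (t, y) := by
  let pullback : (E →L[ℝ] ℝ) →L[ℝ] (ℝ × E →L[ℝ] ℝ) :=
    (ContinuousLinearMap.compL ℝ (ℝ × E) E ℝ).flip (ContinuousLinearMap.snd ℝ ℝ E)
  have ha' : ContDiffAt ℝ n (fun p : ℝ × E => a p.1) (t, y) := ha.comp (t, y) contDiffAt_fst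
  have hH' : ContDiffAt ℝ n (fun p : ℝ × E => H p.2) (t, y) := hH.comp (t, y) contDiffAt_snd
  have hpullback : ContDiffAt ℝ n
      (fun p : ℝ × E => (pullback.comp (H p.2)).comp (ContinuousLinearMap.snd ℝ ℝ E)) (t, y) :=
    (contDiffAt_const.clm_comp hH').clm_comp contDiffAt_const
  exact contDiffAt_const.add ((ha'.pow 2).smul hpullback)

theorem IsPseudoRiemannianAt.coordWarped (ha : ContDiffAt ℝ 2 a t) (h0 : a t ≠ 0)
    (hH : IsPseudoRiemannianAt H y) : IsPseudoRiemannianAt (coordWarped a H) (t, y) where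
  contDiffAt := contDiffAt_coordWarped ha hH.contDiffAt
  eventually_symm := by
    rw [nhds_prod_eq]
    filter_upwards [hH.eventually_symm.prod_inr (𝓝 t)] with p hp V W
    rw [coordWarped_apply, coordWarped_apply, hp, mul_comm V.1]
  isInvertible := isInvertible_coordWarped h0 hH.isInvertible

theorem hasFDerivAt_comp_fst {F : Type*} [NormedAddCommGroup F] [NormedSpace ℝ F] {f : ℝ → F}
    {f' : F} (hf : HasDerivAt f f' t) :
    HasFDerivAt (fun p : ℝ × E => f p.1)
      ((ContinuousLinearMap.fst ℝ ℝ E).smulRight f') (t, y) := by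
  refine (hf.hasFDerivAt.comp (t, y) hasFDerivAt_fst).congr_fderiv ?_
  ext <;> simp

theorem hasFDerivAt_comp_snd {F : Type*} [NormedAddCommGroup F] [NormedSpace ℝ F] {f : E → F}
    (hf : DifferentiableAt ℝ f y) :
    HasFDerivAt (fun p : ℝ × E => f p.2)
      ((fderiv ℝ f y).comp (ContinuousLinearMap.snd ℝ ℝ E)) (t, y) :=
  hf.hasFDerivAt.comp (t, y) hasFDerivAt_snd

theorem fderiv_coordWarped (ha : ContDiffAt ℝ 1 a t) (hH : ContDiffAt ℝ 1 H y) (U V W : ℝ × E) :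
    fderiv ℝ (coordWarped a H) (t, y) U V W =
      2 * a t * deriv a t * U.1 * H y V.2 W.2 + a t ^ 2 * fderiv ℝ H y U.2 V.2 W.2 := by
  have hHd := hH.differentiableAt one_ne_zero
  have hsq := hasFDerivAt_comp_fst (E := E) (y := y)
    ((ha.differentiableAt one_ne_zero).hasDerivAt.fun_pow 2)
  have hHVW := hasFDerivAt_comp_snd (t := t)
    ((hHd.clm_apply (differentiableAt_const V.2)).clm_apply (differentiableAt_const W.2))
  have hsum := (hsq.fun_mul hHVW).const_add (-(V.1 * W.1))
  rw [fderiv_clm_apply₂ ((contDiffAt_coordWarped ha hH).differentiableAt one_ne_zero),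
    fderiv_clm_apply₂ hHd]
  simp only [coordWarped_apply]
  rw [hsum.fderiv]
  simp only [Nat.cast_ofNat, Nat.add_one_sub_one, pow_one, add_apply, smul_apply,
    ContinuousLinearMap.comp_apply, ContinuousLinearMap.coe_snd', smul_eq_mul,
    ContinuousLinearMap.smulRight_apply, ContinuousLinearMap.coe_fst']
  ring

theorem christoffel_coordWarped (ha : ContDiffAt ℝ 1 a t) (h0 : a t ≠ 0)
    (hH : ContDiffAt ℝ 1 H y) (hHi : (H y).IsInvertible) (V W : ℝ × E) :
    christoffel (coordWarped a H) (t, y) V W = (a t * deriv a t * H y V.2 W.2,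
      christoffel H y V.2 W.2 + (deriv a t / a t) • (V.1 • W.2 + W.1 • V.2)) := by
  refine christoffel_eq_of_koszul (isInvertible_coordWarped h0 hHi) fun Z => ?_
  simp only [fderiv_coordWarped ha hH, coordWarped_apply, map_add, map_smul, add_apply,
    smul_apply, smul_eq_mul, apply_christoffel hHi]
  field_simp
  ring

theorem hasDerivAt_deriv_of_contDiffAt_two (ha : ContDiffAt ℝ 2 a t) :
    HasDerivAt (deriv a) (deriv (deriv a) t) t := by
  have hfd : ContDiffAt ℝ 1 (fderiv ℝ a) t := ha.fderiv_right one_add_one_eq_two.le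
  exact ((hfd.clm_apply contDiffAt_const).differentiableAt one_ne_zero).hasDerivAt

theorem fderiv_christoffel_coordWarped [CompleteSpace E] (ha : ContDiffAt ℝ 2 a t)
    (h0 : a t ≠ 0) (hH : IsPseudoRiemannianAt H y) (U V W : ℝ × E) :
    fderiv ℝ (christoffel (coordWarped a H)) (t, y) U V W =
      (U.1 * (deriv a t ^ 2 + a t * deriv (deriv a) t) * H y V.2 W.2
          + a t * deriv a t * fderiv ℝ H y U.2 V.2 W.2,
        fderiv ℝ (christoffel H) y U.2 V.2 W.2
          + (U.1 * (deriv (deriv a) t / a t - (deriv a t / a t) ^ 2)) •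
            (V.1 • W.2 + W.1 • V.2)) := by
  have ha' : HasDerivAt a (deriv a t) t := (ha.differentiableAt two_ne_zero).hasDerivAt
  have ha'' := hasDerivAt_deriv_of_contDiffAt_two ha
  have hHd := hH.differentiableAt
  have hΓ := hH.differentiableAt_christoffel
  have hΓwarped : (fun p => christoffel (coordWarped a H) p V W) =ᶠ[𝓝 (t, y)] fun p =>
      (a p.1 * deriv a p.1 * H p.2 V.2 W.2,
        christoffel H p.2 V.2 W.2 + (deriv a p.1 / a p.1) • (V.1 • W.2 + W.1 • V.2)) := by
    rw [nhds_prod_eq]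
    filter_upwards [((ha.eventually (by simp)).and
      (ha.continuousAt.eventually_ne h0)).prod_mk hH.eventually] with p hp
    exact christoffel_coordWarped (hp.1.1.of_le one_le_two) hp.1.2
      (hp.2.contDiffAt.of_le one_le_two) hp.2.isInvertible V W
  have hHVW := hasFDerivAt_comp_snd (t := t)
    ((hHd.clm_apply (differentiableAt_const V.2)).clm_apply (differentiableAt_const W.2))
  have hΓVW := hasFDerivAt_comp_snd (t := t)
    ((hΓ.clm_apply (differentiableAt_const V.2)).clm_apply (differentiableAt_const W.2))
  have hderiv := ((hasFDerivAt_comp_fst (ha'.fun_mul ha'')).fun_mul hHVW).prodMk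
    (hΓVW.fun_add ((hasFDerivAt_comp_fst (ha''.fun_div ha' h0)).smul_const
      (V.1 • W.2 + W.1 • V.2)))
  rw [fderiv_clm_apply₂ (hH.coordWarped ha h0).differentiableAt_christoffel,
    fderiv_clm_apply₂ hHd, fderiv_clm_apply₂ hΓ, hΓwarped.fderiv_eq, hderiv.fderiv]
  ext
  · simp only [ContinuousLinearMap.prod_apply, add_apply, smul_apply,
      ContinuousLinearMap.comp_apply, ContinuousLinearMap.coe_snd', smul_eq_mul,
      ContinuousLinearMap.smulRight_apply, ContinuousLinearMap.coe_fst']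
    ring
  · simp only [ContinuousLinearMap.prod_apply, add_apply, smul_apply,
      ContinuousLinearMap.comp_apply, ContinuousLinearMap.coe_snd', smul_eq_mul,
      ContinuousLinearMap.smulRight_apply, ContinuousLinearMap.coe_fst', smul_add]
    match_scalars <;> field_simp

theorem coordRiemann_coordWarped [CompleteSpace E] (ha : ContDiffAt ℝ 2 a t) (h0 : a t ≠ 0)
    (hH : IsPseudoRiemannianAt H y) (U V W : ℝ × E) :
    coordRiemann (coordWarped a H) (t, y) U V W =
      (a t * deriv (deriv a) t * (U.1 * H y V.2 W.2 - V.1 * H y U.2 W.2),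
        coordRiemann H y U.2 V.2 W.2
          + (radialCurvature a t * W.1) • (U.1 • V.2 - V.1 • U.2)
          + deriv a t ^ 2 • (H y V.2 W.2 • U.2 - H y U.2 W.2 • V.2)) := by
  rw [coordRiemann_apply]
  simp only [fderiv_christoffel_coordWarped ha h0 hH, radialCurvature,
    christoffel_coordWarped (ha.of_le one_le_two) h0 (hH.contDiffAt.of_le one_le_two)
      hH.isInvertible]
  ext
  · simp only [Prod.fst_add, Prod.fst_sub, map_add, map_smul, smul_eq_mul, hH.metric_compatible,
      hH.christoffel_symm V.2 U.2, hH.symm V.2 U.2, hH.symm V.2 (christoffel H y U.2 W.2)]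
    field_simp
    ring
  · simp only [Prod.snd_add, Prod.snd_sub, map_add, map_smul, coordRiemann_apply,
      hH.christoffel_symm V.2 U.2]
    match_scalars <;> field_simp <;> ring

section ConstantCurvature

variable [FiniteDimensional ℝ E] {k : ℝ}

theorem coordRicci_coordWarped (ha : ContDiffAt ℝ 2 a t) (h0 : a t ≠ 0)
    (hH : IsPseudoRiemannianAt H y)
    (hk : ∀ u v w, coordRiemann H y u v w = k • (H y v w • u - H y u w • v)) (V W : ℝ × E) :
    coordRicci (coordWarped a H) (t, y) V W =
      -(Module.finrank ℝ E * radialCurvature a t * (V.1 * W.1))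
        + (radialCurvature a t + (Module.finrank ℝ E - 1) * spatialCurvature a k t)
          * (a t ^ 2 * H y V.2 W.2) := by
  set T := (((coordRiemann (coordWarped a H) (t, y)).flip V).flip W).toLinearMap with hT
  have hTapply (U : ℝ × E) : T U = coordRiemann (coordWarped a H) (t, y) U V W := rfl
  have htime : LinearMap.fst ℝ ℝ E ∘ₗ T ∘ₗ LinearMap.inl ℝ ℝ E =
      (radialCurvature a t * (a t ^ 2 * H y V.2 W.2)) • LinearMap.id := by
    ext
    simp only [LinearMap.coe_comp, LinearMap.coe_fst, LinearMap.coe_inl, Function.comp_apply,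
      hTapply, coordRiemann_coordWarped ha h0 hH, one_mul, map_zero, zero_apply, mul_zero,
      sub_zero, radialCurvature, LinearMap.smul_apply, LinearMap.id_coe, id_eq, smul_eq_mul,
      mul_one]
    field_simp
  have hspace : LinearMap.snd ℝ ℝ E ∘ₗ T ∘ₗ LinearMap.inr ℝ ℝ E =
      (spatialCurvature a k t * (a t ^ 2 * H y V.2 W.2) - radialCurvature a t * (V.1 * W.1)) •
        LinearMap.id
      - (spatialCurvature a k t * a t ^ 2) • ((H y).flip W.2).toLinearMap.smulRight V.2 := by
    ext u
    simp only [LinearMap.coe_comp, LinearMap.coe_snd, LinearMap.coe_inr, Function.comp_apply,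
      hTapply, coordRiemann_coordWarped ha h0 hH, zero_smul, zero_sub, smul_neg, hk,
      spatialCurvature, LinearMap.sub_apply, LinearMap.smul_apply, LinearMap.id_coe, id_eq,
      LinearMap.coe_smulRight, ContinuousLinearMap.coe_coe, ContinuousLinearMap.flip_apply]
    match_scalars <;> field_simp <;> ring
  rw [coordRicci_apply, ← hT, trace_prod, htime, hspace]
  simp only [map_sub, map_smul, LinearMap.trace_id, LinearMap.trace_smulRight,
    Module.finrank_self, Nat.cast_one, smul_eq_mul, mul_one, ContinuousLinearMap.coe_coe,
    ContinuousLinearMap.flip_apply]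
  ring

theorem coordScalar_coordWarped (ha : ContDiffAt ℝ 2 a t) (h0 : a t ≠ 0)
    (hH : IsPseudoRiemannianAt H y)
    (hk : ∀ u v w, coordRiemann H y u v w = k • (H y v w • u - H y u w • v)) :
    coordScalar (coordWarped a H) (t, y) =
      Module.finrank ℝ E * (2 * radialCurvature a t
        + (Module.finrank ℝ E - 1) * spatialCurvature a k t) := by
  have hraise : (coordWarped a H (t, y)).inverse.toLinearMap ∘ₗ
      (LinearMap.toContinuousLinearMap : (ℝ × E →ₗ[ℝ] ℝ) ≃ₗ[ℝ] (ℝ × E →L[ℝ] ℝ)).toLinearMap ∘ₗ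
        coordRicci (coordWarped a H) (t, y) =
      LinearMap.prodMap ((Module.finrank ℝ E * radialCurvature a t) • LinearMap.id)
        ((radialCurvature a t + (Module.finrank ℝ E - 1) * spatialCurvature a k t) •
          LinearMap.id) := by
    refine LinearMap.ext fun V =>
      ((isInvertible_coordWarped h0 hH.isInvertible).inverse_apply_eq).2 ?_
    ext
    · simp [coordRicci_coordWarped ha h0 hH hk, coordWarped_apply]
    · simp only [LinearMap.coe_comp, LinearEquiv.coe_coe, Function.comp_apply,
        ContinuousLinearMap.comp_apply, ContinuousLinearMap.inr_apply,
        LinearMap.coe_toContinuousLinearMap', coordRicci_coordWarped ha h0 hH hk, mul_zero,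
        neg_zero, zero_add, LinearMap.prodMap_apply, LinearMap.smul_apply, LinearMap.id_coe,
        id_eq, coordWarped_apply, map_smul, smul_apply, smul_eq_mul]
      ring
  rw [coordScalar, hraise]
  simp only [LinearMap.trace_prodMap', map_smul, LinearMap.trace_id, Module.finrank_self,
    smul_eq_mul]
  push_cast
  ring

end ConstantCurvature

end CoordWarped

/-! ### Riemannian metrics in charts -/

theorem contMDiffWithinAt_metric_inner {EB : Type*} [NormedAddCommGroup EB] [NormedSpace ℝ EB]
    {HB : Type*} [TopologicalSpace HB] {IB : ModelWithCorners ℝ EB HB}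
    {B : Type*} [TopologicalSpace B] [ChartedSpace HB B] {n : WithTop ℕ∞}
    {F : Type*} [NormedAddCommGroup F] [NormedSpace ℝ F]
    {V : B → Type*} [TopologicalSpace (Bundle.TotalSpace F V)] [∀ b, TopologicalSpace (V b)]
    [∀ b, AddCommGroup (V b)] [∀ b, Module ℝ (V b)]
    [FiberBundle F V] [VectorBundle ℝ F V]
    {EM : Type*} [NormedAddCommGroup EM] [NormedSpace ℝ EM]
    {HM : Type*} [TopologicalSpace HM] {IM : ModelWithCorners ℝ EM HM}
    {M : Type*} [TopologicalSpace M] [ChartedSpace HM M]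
    (h : Bundle.ContMDiffRiemannianMetric IB n F V) {b : M → B} {v w : ∀ x, V (b x)} {s : Set M}
    {x : M}
    (hv : ContMDiffWithinAt IM (IB.prod 𝓘(ℝ, F)) n
      (fun m => Bundle.TotalSpace.mk' F (b m) (v m)) s x)
    (hw : ContMDiffWithinAt IM (IB.prod 𝓘(ℝ, F)) n
      (fun m => Bundle.TotalSpace.mk' F (b m) (w m)) s x) :
    ContMDiffWithinAt IM 𝓘(ℝ, ℝ) n (fun m => h.inner (b m) (v m) (w m)) s x := by
  have hb : ContMDiffWithinAt IM IB n b s x := (Bundle.contMDiffWithinAt_totalSpace.1 hv).1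
  have hsection : ContMDiffWithinAt IM (IB.prod 𝓘(ℝ, ℝ)) n
      (fun m => Bundle.TotalSpace.mk' ℝ (E := Bundle.Trivial B ℝ) (b m)
        (h.inner (b m) (v m) (w m))) s x :=
    (h.contMDiff.contMDiffAt.comp_contMDiffWithinAt x hb).clm_bundle_apply₂ (F₁ := F) (F₂ := F)
      hv hw
  exact (Bundle.contMDiffWithinAt_totalSpace.1 hsection).2

section Manifold

variable {E : Type*} [NormedAddCommGroup E] [NormedSpace ℝ E]
  {H : Type*} [TopologicalSpace H] {I : ModelWithCorners ℝ E H} [I.Boundaryless]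
  {M : Type*} [TopologicalSpace M] [ChartedSpace H M] [IsManifold I ∞ M]

theorem chartMetric_self (g : BilinField I M) (x : M) :
    chartMetric g x (extChartAt I x x) = g x := by
  have hbase : ∀ x' : M, x' = x → ∀ v w : E, (g x' v w : ℝ) = g x v w := by
    rintro _ rfl _ _
    rfl
  have hd : mfderiv 𝓘(ℝ, E) I (extChartAt I x).symm (extChartAt I x x) =
      ContinuousLinearMap.id ℝ E := by
    have : IsManifold I 1 M := .of_le (n := ∞) (by simp)
    simpa [I.range_eq_univ] using! mfderivWithin_range_extChartAt_symm (I := I) (x := x)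
  refine ContinuousLinearMap.ext fun v => ContinuousLinearMap.ext fun w => ?_
  rw [chartMetric_apply, hd]
  exact hbase _ (extChartAt_to_inv x) v w

theorem contMDiffOn_mfderiv_extChartAt_symm (x : M) (v : E) :
    ContMDiffOn 𝓘(ℝ, E) (I.prod 𝓘(ℝ, E)) ∞
      (fun y => Bundle.TotalSpace.mk' E (E := fun m : M => TangentSpace I m)
        ((extChartAt I x).symm y) (mfderiv 𝓘(ℝ, E) I (extChartAt I x).symm y v))
      (extChartAt I x).target := by
  have ho : IsOpen (extChartAt I x).target := isOpen_extChartAt_target x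
  have htangent := (contMDiffOn_extChartAt_symm (I := I) (n := ∞) x).contMDiffOn_tangentMapWithin
    (m := ∞) (by simp) ho.uniqueMDiffOn
  have hconst : ContMDiffOn 𝓘(ℝ, E) (𝓘(ℝ, E).prod 𝓘(ℝ, E)) ∞
      (fun y : E => Bundle.TotalSpace.mk' E (E := fun m : E => TangentSpace 𝓘(ℝ, E) m) y v)
      (extChartAt I x).target :=
    contMDiffOn_vectorSpace_iff_contDiffOn.2 contDiffOn_const
  refine (htangent.comp hconst fun y hy => hy).congr fun y hy => ?_
  simp only [Function.comp_def, tangentMapWithin]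
  rw [mfderivWithin_of_isOpen ho hy]

theorem apply_sq_lt_of_pos_of_linearIndependent {B : E →L[ℝ] E →L[ℝ] ℝ}
    (hsymm : ∀ v w, B v w = B w v) (hpos : ∀ v ≠ 0, 0 < B v v) {v w : E}
    (hvw : LinearIndependent ℝ ![v, w]) : B v w ^ 2 < B v v * B w w :=
  (LinearMap.BilinForm.apply_sq_lt_iff_linearIndependent_of_symm (B := B.toBilinForm) hpos
    ⟨hsymm⟩ v w).2 hvw

variable (h : Bundle.ContMDiffRiemannianMetric I ∞ E (fun m : M => TangentSpace I m))

theorem chartMetric_self_pos (x : M) {v : E} (hv : v ≠ 0) :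
    0 < chartMetric (fun m => h.inner m) x (extChartAt I x x) v v := by
  rw [chartMetric_self]
  exact h.pos x v hv

variable [FiniteDimensional ℝ E]

theorem contDiffOn_chartMetric (x : M) :
    ContDiffOn ℝ ∞ (chartMetric (fun m => h.inner m) x) (extChartAt I x).target := by
  refine contDiffOn_clm_apply.2 fun v => contDiffOn_clm_apply.2 fun w => ?_
  rw [← contMDiffOn_iff_contDiffOn]
  exact fun y hy => contMDiffWithinAt_metric_inner h
    (contMDiffOn_mfderiv_extChartAt_symm x v y hy) (contMDiffOn_mfderiv_extChartAt_symm x w y hy)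

theorem isInvertible_of_pos {B : E →L[ℝ] E →L[ℝ] ℝ} (hB : ∀ v ≠ 0, 0 < B v v) :
    B.IsInvertible := by
  have hinj : Function.Injective B.toLinearMap :=
    (injective_iff_map_eq_zero B.toLinearMap).2 fun v hv => by
      by_contra h0
      exact (hB v h0).ne' (congrArg (· v) hv)
  have hdim : Module.finrank ℝ E = Module.finrank ℝ (E →L[ℝ] ℝ) := by
    rw [← (LinearMap.toContinuousLinearMap : (E →ₗ[ℝ] ℝ) ≃ₗ[ℝ] (E →L[ℝ] ℝ)).finrank_eq]
    exact (Subspace.dual_finrank_eq (K := ℝ) (V := E)).symm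
  exact ⟨(LinearMap.linearEquivOfInjective B.toLinearMap hinj hdim).toContinuousLinearEquiv, rfl⟩

theorem isPseudoRiemannianAt_chartMetric (x : M) :
    IsPseudoRiemannianAt (chartMetric (fun m => h.inner m) x) (extChartAt I x x) where
  contDiffAt := ((contDiffOn_chartMetric h x).contDiffAt
    (extChartAt_target_mem_nhds x)).of_le (WithTop.coe_le_coe.2 le_top)
  eventually_symm := .of_forall fun y _ _ => h.symm ((extChartAt I x).symm y) _ _
  isInvertible := isInvertible_of_pos fun _ => chartMetric_self_pos h x

theorem coordRiemann_chartMetric_of_hasConstantCurvature {k : ℝ}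
    (hk : HasConstantCurvature (fun m => h.inner m) k) (x : M) (u v w : E) :
    coordRiemann (chartMetric (fun m => h.inner m) x) (extChartAt I x x) u v w =
      k • (chartMetric (fun m => h.inner m) x (extChartAt I x x) v w • u
        - chartMetric (fun m => h.inner m) x (extChartAt I x x) u w • v) := by
  set G := chartMetric (fun m => h.inner m) x
  set y := extChartAt I x x
  have hG : IsPseudoRiemannianAt G y := isPseudoRiemannianAt_chartMetric h x
  refine hG.coordRiemann_eq_of_sectional (fun v w => ?_) u v w
  by_cases hvw : LinearIndependent ℝ ![v, w]
  · have hgram := apply_sq_lt_of_pos_of_linearIndependent hG.symm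
      (fun _ => chartMetric_self_pos h x) hvw
    have hsec : G y (coordRiemann G y v w w) v / (G y v v * G y w w - G y v w ^ 2) = k := by
      simp only [G, y, chartMetric_self]
      exact hk x v w hvw
    exact (div_eq_iff (sub_pos.2 hgram).ne').1 hsec
  · obtain rfl | hw := eq_or_ne w 0
    · simp
    obtain ⟨c, rfl⟩ : ∃ c : ℝ, c • w = v := by
      simpa [LinearIndependent.pair_symm_iff, LinearIndependent.pair_iff' hw] using hvw
    have hself : G y (coordRiemann G y w w w) w = 0 :=
      self_eq_neg.1 (hG.apply_coordRiemann_skew w w w w)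
    simp only [map_smul, smul_apply, hself, smul_eq_mul]
    ring

end Manifold

section Opens

variable {E : Type*} [NormedAddCommGroup E] [NormedSpace ℝ E] {J : TopologicalSpace.Opens E}

theorem mem_extChartAt_opens_source (t s : J) : s ∈ (extChartAt 𝓘(ℝ, E) t).source := by
  rw [extChartAt_source, TopologicalSpace.Opens.chartAt_eq,
    OpenPartialHomeomorph.subtypeRestr_source]
  exact Set.mem_univ _

theorem mem_extChartAt_opens_target (t : J) {s : E} (hs : s ∈ J) :
    s ∈ (extChartAt 𝓘(ℝ, E) t).target :=
  (extChartAt 𝓘(ℝ, E) t).map_source (mem_extChartAt_opens_source t ⟨s, hs⟩)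

theorem extChartAt_opens_symm_apply (t : J) {s : E} (hs : s ∈ J) :
    (extChartAt 𝓘(ℝ, E) t).symm s = ⟨s, hs⟩ :=
  (extChartAt 𝓘(ℝ, E) t).left_inv (mem_extChartAt_opens_source t ⟨s, hs⟩)

theorem mdifferentiableAt_extChartAt_symm {H M : Type*} [TopologicalSpace H]
    {I : ModelWithCorners ℝ E H} [I.Boundaryless] [TopologicalSpace M] [ChartedSpace H M]
    [IsManifold I 1 M] (x : M) {y : E} (hy : y ∈ (extChartAt I x).target) :
    MDifferentiableAt 𝓘(ℝ, E) I (extChartAt I x).symm y := by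
  have h := mdifferentiableWithinAt_extChartAt_symm hy
  rwa [I.range_eq_univ, mdifferentiableWithinAt_univ] at h

theorem hasMFDerivAt_extChartAt_opens_symm (t : J) {s : E} (hs : s ∈ J) :
    HasMFDerivAt 𝓘(ℝ, E) 𝓘(ℝ, E) (extChartAt 𝓘(ℝ, E) t).symm s (ContinuousLinearMap.id ℝ E) := by
  refine ⟨(mdifferentiableAt_extChartAt_symm t (mem_extChartAt_opens_target t hs)).continuousAt, ?_⟩
  have hwritten : writtenInExtChartAt 𝓘(ℝ, E) 𝓘(ℝ, E) s (extChartAt 𝓘(ℝ, E) t).symm =ᶠ[𝓝 s] id := by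
    filter_upwards [J.isOpen.mem_nhds hs] with r hr
    exact congrArg Subtype.val (extChartAt_opens_symm_apply t hr)
  exact ((hasFDerivAt_id s).congr_of_eventuallyEq hwritten).hasFDerivWithinAt

end Opens

/-! ### Curvature of warped products -/

section Warped

variable {E : Type*} [NormedAddCommGroup E] [NormedSpace ℝ E]
  {H : Type*} [TopologicalSpace H] {I : ModelWithCorners ℝ E H}
  {S : Type*} [TopologicalSpace S] [ChartedSpace H S]
  {J : TopologicalSpace.Opens ℝ}

/-- The bilinear form `a(t)² h` at the point `q = (t, s)` of `J × S`. -/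
noncomputable def spatialForm (a : ℝ → ℝ) (h : BilinField I S) (q : J × S) :
    E →L[ℝ] E →L[ℝ] ℝ :=
  a q.1 ^ 2 • (h q.2 : E →L[ℝ] E →L[ℝ] ℝ)

/-- The warped product metric `-dt² + a(t)² h` on `J × S`. -/
noncomputable def warpedMetric (J : TopologicalSpace.Opens ℝ) (a : ℝ → ℝ) (h : BilinField I S) :
    BilinField (𝓘(ℝ, ℝ).prod I) (J × S) :=
  fun q => lorentzForm (spatialForm a h q)

variable {a : ℝ → ℝ} {h : BilinField I S}

theorem warpedMetric_apply (q : J × S) (V W : ℝ × E) :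
    warpedMetric J a h q V W = -(V.1 * W.1) + spatialForm a h q V.2 W.2 := rfl

variable [I.Boundaryless] [IsManifold I ∞ S]

theorem spatialForm_eq_chartMetric (q : J × S) :
    spatialForm a h q = a q.1 ^ 2 • chartMetric h q.2 (extChartAt I q.2 q.2) := by
  rw [chartMetric_self]
  rfl

theorem chartMetric_warpedMetric (q : J × S) {t : ℝ} (ht : t ∈ J) {y : E}
    (hy : y ∈ (extChartAt I q.2).target) :
    chartMetric (warpedMetric J a h) q (t, y) = coordWarped a (chartMetric h q.2) (t, y) := by
  have : IsManifold I 1 S := .of_le (n := ∞) (by simp)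
  have hsymm : ⇑(extChartAt (𝓘(ℝ, ℝ).prod I) q).symm =
      Prod.map (extChartAt 𝓘(ℝ, ℝ) q.1).symm (extChartAt I q.2).symm := by
    rw [extChartAt_prod]
    rfl
  have hpoint : (extChartAt (𝓘(ℝ, ℝ).prod I) q).symm (t, y) =
      (⟨t, ht⟩, (extChartAt I q.2).symm y) := by
    rw [hsymm]
    exact Prod.ext (extChartAt_opens_symm_apply q.1 ht) rfl
  have ht' := hasMFDerivAt_extChartAt_opens_symm q.1 ht
  have hderiv : HasMFDerivAt 𝓘(ℝ, ℝ × E) (𝓘(ℝ, ℝ).prod I)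
      (extChartAt (𝓘(ℝ, ℝ).prod I) q).symm (t, y)
      ((ContinuousLinearMap.id ℝ ℝ).prodMap (mfderiv 𝓘(ℝ, E) I (extChartAt I q.2).symm y)) := by
    have hprod := HasMFDerivAt.prodMap (p := (t, y)) ht'
      (mdifferentiableAt_extChartAt_symm q.2 hy).hasMFDerivAt
    rw [hsymm]
    rw [ht'.mfderiv] at hprod
    exact ⟨hprod.1, hprod.2⟩
  have hbase : ∀ q' r : J × S, q' = r → ∀ V W : ℝ × E,
      (warpedMetric J a h q' V W : ℝ) = warpedMetric J a h r V W := by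
    rintro _ _ rfl _ _
    rfl
  refine ContinuousLinearMap.ext fun V => ContinuousLinearMap.ext fun W => ?_
  rw [chartMetric_apply, hderiv.mfderiv]
  exact hbase _ _ hpoint _ _

theorem chartMetric_warpedMetric_eventuallyEq (q : J × S) :
    chartMetric (warpedMetric J a h) q =ᶠ[𝓝 ((q.1 : ℝ), extChartAt I q.2 q.2)]
      coordWarped a (chartMetric h q.2) := by
  rw [nhds_prod_eq]
  filter_upwards [Filter.prod_mem_prod (J.isOpen.mem_nhds q.1.2)
    (extChartAt_target_mem_nhds q.2)] with p hp
  exact chartMetric_warpedMetric q hp.1 hp.2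

end Warped

section ConstantCurvature

variable {E : Type*} [NormedAddCommGroup E] [NormedSpace ℝ E] [FiniteDimensional ℝ E]
  {H : Type*} [TopologicalSpace H] {I : ModelWithCorners ℝ E H} [I.Boundaryless]
  {S : Type*} [TopologicalSpace S] [ChartedSpace H S] [IsManifold I ∞ S]
  {J : TopologicalSpace.Opens ℝ} {a : ℝ → ℝ} {k : ℝ}
  {h : Bundle.ContMDiffRiemannianMetric I ∞ E (fun s : S => TangentSpace I s)} {q : J × S}

theorem riemann_warpedMetric (hk : HasConstantCurvature (fun s => h.inner s) k)
    (ha : ContDiffAt ℝ 2 a q.1) (h0 : a q.1 ≠ 0) (U V W : ℝ × E) :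
    (riemann (warpedMetric J a fun s => h.inner s) q U V W : ℝ × E) =
      (radialCurvature a q.1 * (U.1 * spatialForm a (fun s => h.inner s) q V.2 W.2
          - V.1 * spatialForm a (fun s => h.inner s) q U.2 W.2),
        (radialCurvature a q.1 * W.1) • (U.1 • V.2 - V.1 • U.2)
          + spatialCurvature a k q.1 • (spatialForm a (fun s => h.inner s) q V.2 W.2 • U.2
            - spatialForm a (fun s => h.inner s) q U.2 W.2 • V.2)) := by
  change coordRiemann (chartMetric (warpedMetric J a fun s => h.inner s) q)
    ((q.1 : ℝ), extChartAt I q.2 q.2) U V W = _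
  rw [coordRiemann_congr (chartMetric_warpedMetric_eventuallyEq q),
    coordRiemann_coordWarped ha h0 (isPseudoRiemannianAt_chartMetric h q.2),
    coordRiemann_chartMetric_of_hasConstantCurvature h hk]
  simp only [spatialForm_eq_chartMetric, smul_apply, smul_eq_mul, radialCurvature, spatialCurvature]
  ext
  · simp only
    field_simp
  · simp only
    match_scalars <;> field_simp <;> ring

theorem ricci_warpedMetric (hk : HasConstantCurvature (fun s => h.inner s) k)
    (ha : ContDiffAt ℝ 2 a q.1) (h0 : a q.1 ≠ 0) (V W : ℝ × E) :
    ricci (warpedMetric J a fun s => h.inner s) q V W =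
      -(Module.finrank ℝ E * radialCurvature a q.1 * (V.1 * W.1))
        + (radialCurvature a q.1 + (Module.finrank ℝ E - 1) * spatialCurvature a k q.1)
          * spatialForm a (fun s => h.inner s) q V.2 W.2 := by
  change coordRicci (chartMetric (warpedMetric J a fun s => h.inner s) q)
    ((q.1 : ℝ), extChartAt I q.2 q.2) V W = _
  rw [coordRicci_congr (chartMetric_warpedMetric_eventuallyEq q),
    coordRicci_coordWarped ha h0 (isPseudoRiemannianAt_chartMetric h q.2)
      (coordRiemann_chartMetric_of_hasConstantCurvature h hk q.2), spatialForm_eq_chartMetric]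
  rfl

theorem scalar_warpedMetric (hk : HasConstantCurvature (fun s => h.inner s) k)
    (ha : ContDiffAt ℝ 2 a q.1) (h0 : a q.1 ≠ 0) :
    scalar (warpedMetric J a fun s => h.inner s) q =
      Module.finrank ℝ E * (2 * radialCurvature a q.1
        + (Module.finrank ℝ E - 1) * spatialCurvature a k q.1) := by
  change coordScalar (chartMetric (warpedMetric J a fun s => h.inner s) q)
    ((q.1 : ℝ), extChartAt I q.2 q.2) = _
  rw [coordScalar_congr (chartMetric_warpedMetric_eventuallyEq q),
    coordScalar_coordWarped ha h0 (isPseudoRiemannianAt_chartMetric h q.2)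
      (coordRiemann_chartMetric_of_hasConstantCurvature h hk q.2)]

end ConstantCurvature

/-! ### Timelike planes and timelike vectors of a Lorentzian form -/

theorem forall_nonneg_add_mul_nonpos_iff {b m : ℝ} :
    (∀ x, 0 ≤ x → b + m * x ≤ 0) ↔ b ≤ 0 ∧ m ≤ 0 := by
  refine ⟨fun h => ⟨by simpa using h 0 le_rfl, ?_⟩, fun ⟨hb, hm⟩ x hx =>
    add_nonpos hb (mul_nonpos_of_nonpos_of_nonneg hm hx)⟩
  by_contra! hm
  have hb : b ≤ 0 := by simpa using h 0 le_rfl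
  have hx := h ((1 - b) / m) (div_nonneg (by linarith) hm.le)
  rw [mul_div_cancel₀ _ hm.ne'] at hx
  linarith

theorem forall_mem_Ico_add_mul_nonneg_iff {b m : ℝ} :
    (∀ x ∈ Set.Ico (0 : ℝ) 1, 0 ≤ b + m * x) ↔ 0 ≤ b ∧ 0 ≤ b + m := by
  constructor
  · intro h
    have hclosure : Set.Icc (0 : ℝ) 1 ⊆ {x | 0 ≤ b + m * x} := by
      rw [← closure_Ico zero_ne_one]
      exact closure_minimal h (isClosed_le continuous_const (by fun_prop))
    exact ⟨by simpa using hclosure (Set.left_mem_Icc.2 zero_le_one),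
      by simpa using hclosure (Set.right_mem_Icc.2 zero_le_one)⟩
  · rintro ⟨hb, hbm⟩ x ⟨hx0, hx1⟩
    calc 0 ≤ b * (1 - x) + (b + m) * x :=
          add_nonneg (mul_nonneg hb (sub_nonneg.2 hx1.le)) (mul_nonneg hbm hx0)
      _ = b + m * x := by ring

section LorentzForm

variable {E : Type*} [NormedAddCommGroup E] [NormedSpace ℝ E] {B : E →L[ℝ] E →L[ℝ] ℝ}

theorem apply_inv_sqrt_smul_self {v : E} (hv : 0 < B v v) :
    B ((√(B v v))⁻¹ • v) ((√(B v v))⁻¹ • v) = 1 := by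
  simp only [map_smul, smul_apply, smul_eq_mul]
  rw [← mul_assoc, ← mul_inv, Real.mul_self_sqrt hv.le, inv_mul_cancel₀ hv.ne']

theorem apply_self_nonneg_of_pos (hpos : ∀ v ≠ 0, 0 < B v v) (v : E) : 0 ≤ B v v := by
  obtain rfl | hv := eq_or_ne v 0
  · simp
  · exact (hpos v hv).le

theorem exists_apply_self_eq_one [Nontrivial E] (hpos : ∀ v ≠ 0, 0 < B v v) :
    ∃ e, B e e = 1 := by
  obtain ⟨v, hv⟩ := exists_ne (0 : E)
  exact ⟨_, apply_inv_sqrt_smul_self (hpos v hv)⟩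

theorem exists_orthonormal_pair (hE : 1 < Module.finrank ℝ E) (hpos : ∀ v ≠ 0, 0 < B v v) :
    ∃ e f, B e e = 1 ∧ B f f = 1 ∧ B e f = 0 := by
  have : Nontrivial E := Module.nontrivial_of_finrank_pos (zero_lt_one.trans hE)
  obtain ⟨e, he⟩ := exists_apply_self_eq_one hpos
  have he0 : e ≠ 0 := by
    rintro rfl
    simp at he
  obtain ⟨w, hw⟩ := exists_linearIndependent_pair_of_one_lt_finrank hE he0
  have hproj : w - B e w • e ≠ 0 :=
    fun h => (LinearIndependent.pair_iff' he0).1 hw (B e w) (sub_eq_zero.1 h).symm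
  refine ⟨e, _, he, apply_inv_sqrt_smul_self (hpos _ hproj), ?_⟩
  simp [he]

theorem lorentzForm_timelike_affine_nonneg_iff [Nontrivial E] (hpos : ∀ v ≠ 0, 0 < B v v)
    {b m : ℝ} :
    (∀ X, lorentzForm B X X < 0 → 0 ≤ b * (X.1 * X.1) + m * B X.2 X.2) ↔ 0 ≤ b ∧ 0 ≤ b + m := by
  rw [← forall_mem_Ico_add_mul_nonneg_iff]
  constructor
  · rintro h x ⟨hx0, hx1⟩
    obtain ⟨e, he⟩ := exists_apply_self_eq_one hpos
    have hx : B (√x • e) (√x • e) = x := by simp [he, Real.mul_self_sqrt hx0]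
    have hX : lorentzForm B (1, √x • e) (1, √x • e) < 0 := by
      rw [lorentzForm_apply, hx]
      linarith
    simpa only [hx, mul_one] using h _ hX
  · rintro h ⟨τ, v⟩ hX
    have hτ : B v v < τ * τ := by simpa [lorentzForm_apply] using hX
    have hv : 0 ≤ B v v := apply_self_nonneg_of_pos hpos v
    have hτ0 : 0 < τ * τ := hv.trans_lt hτ
    have hratio := h (B v v / (τ * τ)) ⟨div_nonneg hv hτ0.le, (div_lt_one hτ0).2 hτ⟩
    calc 0 ≤ τ * τ * (b + m * (B v v / (τ * τ))) := mul_nonneg hτ0.le hratio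
      _ = b * (τ * τ) + m * B v v := by
        rw [mul_add, mul_left_comm, mul_div_cancel₀ _ hτ0.ne', mul_comm]

theorem lorentzForm_timelike_orthonormal_forall_iff (hE : 1 < Module.finrank ℝ E)
    (hsymm : ∀ v w, B v w = B w v) (hpos : ∀ v ≠ 0, 0 < B v v) {P : ℝ → Prop} :
    (∀ U V, lorentzForm B U U = -1 → lorentzForm B V V = 1 → lorentzForm B U V = 0 →
      P (B U.2 U.2 * B V.2 V.2 - B U.2 V.2 ^ 2)) ↔ ∀ x, 0 ≤ x → P x := by
  constructor
  · intro h x hx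
    obtain ⟨e, f, he, hf, hef⟩ := exists_orthonormal_pair hE hpos
    have hx' : B (√x • e) (√x • e) = x := by simp [he, Real.mul_self_sqrt hx]
    have hU : lorentzForm B (√(1 + x), √x • e) (√(1 + x), √x • e) = -1 := by
      rw [lorentzForm_apply, hx', Real.mul_self_sqrt (by positivity)]
      ring
    have hgram : B (√x • e) (√x • e) * B f f - B (√x • e) f ^ 2 = x := by
      rw [hx', hf]
      simp [hef]
    rw [← hgram]
    exact h _ (0, f) hU (by simp [lorentzForm_apply, hf]) (by simp [lorentzForm_apply, hef])
  · intro h U V _ _ _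
    exact h _ (sub_nonneg.2 (LinearMap.BilinForm.apply_sq_le_of_symm (B := B.toBilinForm)
      (apply_self_nonneg_of_pos hpos) ⟨hsymm⟩ U.2 V.2))

end LorentzForm

/-! ### Energy conditions of warped products -/

section EnergyConditions

variable {E : Type*} [NormedAddCommGroup E] [NormedSpace ℝ E]
  {H : Type*} [TopologicalSpace H] {I : ModelWithCorners ℝ E H}
  {S : Type*} [TopologicalSpace S] [ChartedSpace H S]
  {J : TopologicalSpace.Opens ℝ} {a : ℝ → ℝ} {k : ℝ}

/-- The vector field `∂_t` on `J × S`. -/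
def timeField (I : ModelWithCorners ℝ E H) (q : J × S) : TangentSpace (𝓘(ℝ, ℝ).prod I) q :=
  ((1, 0) : ℝ × E)

theorem warpedMetric_timeField {h : BilinField I S} (q : J × S) (X : ℝ × E) :
    warpedMetric J a h q (timeField I q) X = -X.1 := by
  change -(1 * X.1) + spatialForm a h q 0 X.2 = -X.1
  simp

variable [IsManifold I ∞ S]
  {h : Bundle.ContMDiffRiemannianMetric I ∞ E (fun s : S => TangentSpace I s)}

theorem spatialForm_symm (q : J × S) (v w : E) :
    spatialForm a (fun s => h.inner s) q v w = spatialForm a (fun s => h.inner s) q w v :=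
  congrArg (a q.1 ^ 2 * ·) (h.symm q.2 v w)

theorem spatialForm_pos {q : J × S} (h0 : a q.1 ≠ 0) (v : E) (hv : v ≠ 0) :
    0 < spatialForm a (fun s => h.inner s) q v v :=
  mul_pos (sq_pos_of_ne_zero h0) (h.pos q.2 v hv)

variable [I.Boundaryless] [FiniteDimensional ℝ E]

theorem sectional_warpedMetric (hk : HasConstantCurvature (fun s => h.inner s) k) {q : J × S}
    (ha : ContDiffAt ℝ 2 a q.1) (h0 : a q.1 ≠ 0) {U V : ℝ × E}
    (hU : warpedMetric J a (fun s => h.inner s) q U U = -1)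
    (hV : warpedMetric J a (fun s => h.inner s) q V V = 1)
    (hUV : warpedMetric J a (fun s => h.inner s) q U V = 0) :
    sectional (warpedMetric J a fun s => h.inner s) q U V = radialCurvature a q.1
      + (radialCurvature a q.1 - spatialCurvature a k q.1)
        * (spatialForm a (fun s => h.inner s) q U.2 U.2
            * spatialForm a (fun s => h.inner s) q V.2 V.2
          - spatialForm a (fun s => h.inner s) q U.2 V.2 ^ 2) := by
  set B := spatialForm a (fun s => h.inner s) q with hB
  have hBsymm : B V.2 U.2 = B U.2 V.2 := spatialForm_symm q V.2 U.2
  have happly := warpedMetric_apply (a := a) (h := fun s => h.inner s) q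
    (riemann (warpedMetric J a fun s => h.inner s) q U V V) U
  change warpedMetric J a (fun s => h.inner s) q (riemann _ q U V V) U
    / (warpedMetric J a (fun s => h.inner s) q U U * warpedMetric J a (fun s => h.inner s) q V V
      - warpedMetric J a (fun s => h.inner s) q U V ^ 2) = _
  rw [hU, hV, hUV, happly, riemann_warpedMetric hk ha h0]
  rw [warpedMetric_apply, ← hB] at hU hV hUV
  simp only [← hB, map_add, map_sub, map_smul, add_apply, sub_apply, smul_apply, smul_eq_mul,
    hBsymm]
  have hUU : B U.2 U.2 = U.1 * U.1 - 1 := by linarith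
  have hVV : B V.2 V.2 = V.1 * V.1 + 1 := by linarith
  have hUV' : B U.2 V.2 = U.1 * V.1 := by linarith
  rw [hUU, hVV, hUV']
  ring

theorem timelikeSectional_warpedMetric_iff (hE : 1 < Module.finrank ℝ E)
    (hk : HasConstantCurvature (fun s => h.inner s) k) {q : J × S}
    (ha : ContDiffAt ℝ 2 a q.1) (h0 : a q.1 ≠ 0) {P : ℝ → Prop} :
    (∀ U V, warpedMetric J a (fun s => h.inner s) q U U = -1 →
      warpedMetric J a (fun s => h.inner s) q V V = 1 →
      warpedMetric J a (fun s => h.inner s) q U V = 0 →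
      P (sectional (warpedMetric J a fun s => h.inner s) q U V)) ↔
    ∀ x, 0 ≤ x → P (radialCurvature a q.1
      + (radialCurvature a q.1 - spatialCurvature a k q.1) * x) := by
  refine Iff.trans ?_ (lorentzForm_timelike_orthonormal_forall_iff hE
    (spatialForm_symm (h := h) q) (spatialForm_pos h0) (P := fun x => P (radialCurvature a q.1
      + (radialCurvature a q.1 - spatialCurvature a k q.1) * x)))
  refine forall₂_congr fun U V => forall₃_congr fun hU hV hUV => ?_
  rw [sectional_warpedMetric hk ha h0 hU hV hUV]

variable (ha : ContDiffOn ℝ 2 a J) (h0 : ∀ t ∈ J, a t ≠ 0)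
  (hk : HasConstantCurvature (fun s => h.inner s) k)

include ha h0 hk

theorem timelikeSectionalNonpos_warpedMetric_iff (hE : 1 < Module.finrank ℝ E) :
    TimelikeSectionalNonpos (warpedMetric J a fun s => h.inner s) ↔
      ∀ q : J × S, radialCurvature a q.1 ≤ 0 ∧
        radialCurvature a q.1 ≤ spatialCurvature a k q.1 := by
  refine forall_congr' fun q => ?_
  rw [← sub_nonpos (b := spatialCurvature a k q.1), ← forall_nonneg_add_mul_nonpos_iff]
  exact timelikeSectional_warpedMetric_iff hE hk (ha.contDiffAt (J.isOpen.mem_nhds q.1.2))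
    (h0 _ q.1.2) (P := (· ≤ 0))

theorem timelikeSectionalNeg_warpedMetric (hE : 1 < Module.finrank ℝ E)
    (hcurv : ∀ q : J × S, radialCurvature a q.1 < 0 ∧
      radialCurvature a q.1 ≤ spatialCurvature a k q.1) :
    TimelikeSectionalNeg (warpedMetric J a fun s => h.inner s) := fun q =>
  (timelikeSectional_warpedMetric_iff hE hk (ha.contDiffAt (J.isOpen.mem_nhds q.1.2))
    (h0 _ q.1.2) (P := (· < 0))).2 fun _ hx =>
      add_neg_of_neg_of_nonpos (hcurv q).1
        (mul_nonpos_of_nonpos_of_nonneg (sub_nonpos.2 (hcurv q).2) hx)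

theorem strongEnergyCondition_warpedMetric_iff (hE : 1 < Module.finrank ℝ E) :
    StrongEnergyCondition (warpedMetric J a fun s => h.inner s) ↔
      ∀ q : J × S, radialCurvature a q.1 ≤ 0 ∧
        radialCurvature a q.1 ≤ spatialCurvature a k q.1 := by
  have : Nontrivial E := Module.nontrivial_of_finrank_pos (zero_lt_one.trans hE)
  have hn : (1 : ℝ) < Module.finrank ℝ E := by exact_mod_cast hE
  refine forall_congr' fun q => ?_
  set r := radialCurvature a q.1
  set c := spatialCurvature a k q.1
  calc (∀ X, _ → 0 ≤ ricci _ q X X)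
    _ ↔ ∀ X, lorentzForm (spatialForm a (fun s => h.inner s) q) X X < 0 →
        0 ≤ -(Module.finrank ℝ E * r) * (X.1 * X.1)
          + (r + (Module.finrank ℝ E - 1) * c)
            * spatialForm a (fun s => h.inner s) q X.2 X.2 := by
      refine forall_congr' fun X => imp_congr_right fun _ => ?_
      have hricci := ricci_warpedMetric hk (ha.contDiffAt (J.isOpen.mem_nhds q.1.2))
        (h0 _ q.1.2) X X
      rw [hricci, neg_mul]
    _ ↔ _ := lorentzForm_timelike_affine_nonneg_iff (spatialForm_pos (h0 _ q.1.2))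
    _ ↔ 0 ≤ Module.finrank ℝ E * (-r) ∧ 0 ≤ (Module.finrank ℝ E - 1) * (c - r) := by
      ring_nf
    _ ↔ r ≤ 0 ∧ r ≤ c := by
      rw [mul_nonneg_iff_of_pos_left (by linarith), mul_nonneg_iff_of_pos_left (by linarith),
        neg_nonneg, sub_nonneg]

theorem einsteinPerfectFluid_warpedMetric_iff [Nontrivial E] {ρ p : J × S → ℝ} :
    EinsteinPerfectFluid (warpedMetric J a fun s => h.inner s) (timeField I) ρ p ↔
      ∀ q : J × S,
        8 * Real.pi * ρ q =
          Module.finrank ℝ E * (Module.finrank ℝ E - 1) / 2 * spatialCurvature a k q.1 ∧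
        8 * Real.pi * p q = -(Module.finrank ℝ E - 1) * (radialCurvature a q.1
          + (Module.finrank ℝ E - 2) / 2 * spatialCurvature a k q.1) := by
  refine forall_congr' fun q => ?_
  have ha' := ha.contDiffAt (J.isOpen.mem_nhds q.1.2)
  have h0' := h0 _ q.1.2
  have hscalar := scalar_warpedMetric hk ha' h0'
  constructor
  · intro heq
    obtain ⟨e, he⟩ := exists_apply_self_eq_one (spatialForm_pos (h := h) h0')
    have htime := heq ((1, 0) : ℝ × E) ((1, 0) : ℝ × E)
    have hspace := heq ((0, e) : ℝ × E) ((0, e) : ℝ × E)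
    rw [ricci_warpedMetric hk ha' h0', hscalar, warpedMetric_timeField, warpedMetric_apply]
      at htime hspace
    simp only [map_zero, he] at htime hspace
    exact ⟨by linarith, by linarith⟩
  · rintro ⟨hρ, hp⟩ X Y
    have hricci := ricci_warpedMetric hk ha' h0' X Y
    have hX := warpedMetric_timeField (a := a) (h := fun s => h.inner s) q X
    have hY := warpedMetric_timeField (a := a) (h := fun s => h.inner s) q Y
    have hXY := warpedMetric_apply (a := a) (h := fun s => h.inner s) q X Y
    rw [hricci, hscalar, hX, hY, hXY]
    linear_combination -(Prod.fst X * Prod.fst Y) * hρ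
      - spatialForm a (fun s => h.inner s) q (Prod.snd X) (Prod.snd Y) * hp

end EnergyConditions

section PerfectFluid

variable {E : Type*} [NormedAddCommGroup E] [NormedSpace ℝ E] [FiniteDimensional ℝ E]
  {H : Type*} [TopologicalSpace H] {I : ModelWithCorners ℝ E H} [I.Boundaryless]
  {S : Type*} [TopologicalSpace S] [ChartedSpace H S] [IsManifold I ∞ S]
  {J : TopologicalSpace.Opens ℝ} {a : ℝ → ℝ} {k : ℝ}
  {h : Bundle.ContMDiffRiemannianMetric I ∞ E (fun s : S => TangentSpace I s)}
  (ha : ContDiffOn ℝ 2 a J) (h0 : ∀ t ∈ J, a t ≠ 0)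
  (hk : HasConstantCurvature (fun s => h.inner s) k)

include ha h0 hk

theorem exists_einsteinPerfectFluid_warpedMetric [Nontrivial E] :
    ∃ ρ p, EinsteinPerfectFluid (warpedMetric J a fun s => h.inner s) (timeField I) ρ p := by
  have hpi : 8 * Real.pi ≠ 0 := by positivity
  exact ⟨fun q => _ / (8 * Real.pi), fun q => _ / (8 * Real.pi),
    (einsteinPerfectFluid_warpedMetric_iff ha h0 hk).2 fun q =>
      ⟨mul_div_cancel₀ _ hpi, mul_div_cancel₀ _ hpi⟩⟩

section

variable [Nontrivial E] {ρ p : J × S → ℝ}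
  (hEinstein : EinsteinPerfectFluid (warpedMetric J a fun s => h.inner s) (timeField I) ρ p)

include hEinstein

theorem density_add_pressure_eq (q : J × S) :
    8 * Real.pi * (ρ q + p q) = (Module.finrank ℝ E - 1)
      * (spatialCurvature a k q.1 - radialCurvature a q.1) := by
  obtain ⟨hρ, hp⟩ := (einsteinPerfectFluid_warpedMetric_iff ha h0 hk).1 hEinstein q
  linear_combination hρ + hp

theorem weighted_density_add_pressure_eq (q : J × S) :
    8 * Real.pi * ((Module.finrank ℝ E - 2) * ρ q + Module.finrank ℝ E * p q) =
      Module.finrank ℝ E * (Module.finrank ℝ E - 1) * -radialCurvature a q.1 := by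
  obtain ⟨hρ, hp⟩ := (einsteinPerfectFluid_warpedMetric_iff ha h0 hk).1 hEinstein q
  linear_combination (Module.finrank ℝ E - 2 : ℝ) * hρ + (Module.finrank ℝ E : ℝ) * hp

end

variable (hE : 1 < Module.finrank ℝ E) {ρ p : J × S → ℝ}
  (hEinstein : EinsteinPerfectFluid (warpedMetric J a fun s => h.inner s) (timeField I) ρ p)

include hE hEinstein

theorem density_add_pressure_nonneg_iff (q : J × S) :
    0 ≤ ρ q + p q ↔ radialCurvature a q.1 ≤ spatialCurvature a k q.1 := by
  have : Nontrivial E := Module.nontrivial_of_finrank_pos (zero_lt_one.trans hE)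
  have hn : (0 : ℝ) < Module.finrank ℝ E - 1 := sub_pos.2 (by exact_mod_cast hE)
  rw [← mul_nonneg_iff_of_pos_left (by positivity : 0 < 8 * Real.pi),
    density_add_pressure_eq ha h0 hk hEinstein, mul_nonneg_iff_of_pos_left hn, sub_nonneg]

theorem weighted_density_add_pressure_nonneg_iff (q : J × S) :
    0 ≤ (Module.finrank ℝ E - 2) * ρ q + Module.finrank ℝ E * p q ↔
      radialCurvature a q.1 ≤ 0 := by
  have : Nontrivial E := Module.nontrivial_of_finrank_pos (zero_lt_one.trans hE)
  have hn : (0 : ℝ) < Module.finrank ℝ E - 1 := sub_pos.2 (by exact_mod_cast hE)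
  rw [← mul_nonneg_iff_of_pos_left (by positivity : 0 < 8 * Real.pi),
    weighted_density_add_pressure_eq ha h0 hk hEinstein,
    mul_nonneg_iff_of_pos_left (by positivity), neg_nonneg]

theorem weighted_density_add_pressure_pos_iff (q : J × S) :
    0 < (Module.finrank ℝ E - 2) * ρ q + Module.finrank ℝ E * p q ↔
      radialCurvature a q.1 < 0 := by
  have : Nontrivial E := Module.nontrivial_of_finrank_pos (zero_lt_one.trans hE)
  have hn : (0 : ℝ) < Module.finrank ℝ E - 1 := sub_pos.2 (by exact_mod_cast hE)
  rw [← mul_pos_iff_of_pos_left (by positivity : 0 < 8 * Real.pi),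
    weighted_density_add_pressure_eq ha h0 hk hEinstein,
    mul_pos_iff_of_pos_left (by positivity), neg_pos]

theorem timelikeSectionalNonpos_iff_density_pressure :
    TimelikeSectionalNonpos (warpedMetric J a fun s => h.inner s) ↔ ∀ q : J × S,
      0 ≤ ρ q + p q ∧ 0 ≤ (Module.finrank ℝ E - 2) * ρ q + Module.finrank ℝ E * p q := by
  rw [timelikeSectionalNonpos_warpedMetric_iff ha h0 hk hE]
  exact forall_congr' fun q => by
    rw [density_add_pressure_nonneg_iff ha h0 hk hE hEinstein,
      weighted_density_add_pressure_nonneg_iff ha h0 hk hE hEinstein, and_comm]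

end PerfectFluid

end FLRW

open FLRW in
theorem mainTheorem4_general {E : Type*} [NormedAddCommGroup E] [NormedSpace ℝ E]
    [FiniteDimensional ℝ E] (hE : 3 ≤ Module.finrank ℝ E)
    {H : Type*} [TopologicalSpace H] {I : ModelWithCorners ℝ E H} [I.Boundaryless]
    {S : Type*} [TopologicalSpace S] [ChartedSpace H S] [IsManifold I ∞ S]
    {J : TopologicalSpace.Opens ℝ} {a : ℝ → ℝ} (ha : ContDiffOn ℝ 2 a J) (h0 : ∀ t ∈ J, a t ≠ 0)
    {h : Bundle.ContMDiffRiemannianMetric I ∞ E (fun s : S => TangentSpace I s)} {k : ℝ}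
    (hk : HasConstantCurvature (fun s => h.inner s) k) :
    let g := warpedMetric J a fun s => h.inner s
    let n : ℝ := Module.finrank ℝ E
    (∃ ρ p, EinsteinPerfectFluid g (timeField I) ρ p) ∧
    (TimelikeSectionalNonpos g ↔ StrongEnergyCondition g) ∧
    ∀ ρ p, EinsteinPerfectFluid g (timeField I) ρ p →
      (TimelikeSectionalNonpos g ↔ ∀ q, 0 ≤ ρ q + p q ∧ 0 ≤ (n - 2) * ρ q + n * p q) ∧
      ((∀ q, 0 ≤ ρ q + p q ∧ 0 ≤ (n - 2) * ρ q + n * p q) ↔ StrongEnergyCondition g) ∧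
      ((∀ q, 0 < ρ q ∧ 0 ≤ p q) → TimelikeSectionalNeg g) := by
  intro g n
  have hE' : 1 < Module.finrank ℝ E := by omega
  have : Nontrivial E := Module.nontrivial_of_finrank_pos (zero_lt_one.trans hE')
  have hn : (3 : ℝ) ≤ Module.finrank ℝ E := by exact_mod_cast hE
  have hiff : TimelikeSectionalNonpos g ↔ StrongEnergyCondition g :=
    (timelikeSectionalNonpos_warpedMetric_iff ha h0 hk hE').trans
      (strongEnergyCondition_warpedMetric_iff ha h0 hk hE').symm
  refine ⟨exists_einsteinPerfectFluid_warpedMetric ha h0 hk, hiff, fun ρ p hEinstein => ?_⟩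
  have hfluid := timelikeSectionalNonpos_iff_density_pressure ha h0 hk hE' hEinstein
  refine ⟨hfluid, hfluid.symm.trans hiff, fun hpos =>
    timelikeSectionalNeg_warpedMetric ha h0 hk hE' fun q => ⟨?_, ?_⟩⟩
  · refine (weighted_density_add_pressure_pos_iff ha h0 hk hE' hEinstein q).1 ?_
    exact add_pos_of_pos_of_nonneg (mul_pos (by linarith) (hpos q).1)
      (mul_nonneg (by positivity) (hpos q).2)
  · refine (density_add_pressure_nonneg_iff ha h0 hk hE' hEinstein q).1 ?_
    linarith [hpos q]

theorem mainTheorem4 {S : Type*} [TopologicalSpace S]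
    [ChartedSpace (EuclideanSpace ℝ (Fin 3)) S]
    [IsManifold 𝓘(ℝ, EuclideanSpace ℝ (Fin 3)) ∞ S] (F : FLRW.FLRWData S) :
    (∃ ρ p : F.J × S → ℝ, FLRW.EinsteinPerfectFluid F.metric F.comoving ρ p) ∧
    (FLRW.TimelikeSectionalNonpos F.metric ↔ FLRW.StrongEnergyCondition F.metric) ∧
    ∀ ρ p : F.J × S → ℝ, FLRW.EinsteinPerfectFluid F.metric F.comoving ρ p →
      (FLRW.TimelikeSectionalNonpos F.metric ↔ ∀ q, 0 ≤ ρ q + p q ∧ 0 ≤ ρ q + 3 * p q) ∧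
      ((∀ q, 0 ≤ ρ q + p q ∧ 0 ≤ ρ q + 3 * p q) ↔ FLRW.StrongEnergyCondition F.metric) ∧
      ((∀ q, 0 < ρ q ∧ 0 ≤ p q) → FLRW.TimelikeSectionalNeg F.metric) := by
  simpa only [finrank_euclideanSpace_fin, Nat.cast_ofNat, show (3 - 2 : ℝ) = 1 by norm_num, one_mul]
    using! mainTheorem4_general finrank_euclideanSpace_fin.ge
      (F.a_smooth.of_le (WithTop.coe_le_coe.2 le_top)) (fun t ht => (F.a_pos t ht).ne')
      F.constantCurvature
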